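/- Let $N\ge 0$ be an integer and let $A$, $B$ be independent $N\times N$ real Ginibre matrices, i.e. independent random matrices whose entries are independent real standard Gaussian random variables (mean $0$, variance $1$). Then $A$ is almost surely invertible, and the distribution of the random matrix $Y=A^{-1}B$ is absolutely continuous with respect to Lebesgue measure $(dY)=\prod_{i,j}dY_{ij}$ on the space $\mathbb R^{N\times N}$ of real $N\times N$ matrices, with density $$\mathcal P(Y)=\pi^{-N^2/2}\,\prod_{j=0}^{N-1}\frac{\Gamma\big((N+1)/2+j/2\big)}{\Gamma\big((j+1)/2\big)}\;\det(\mathbf 1_N+YY^{T})^{-N}.$$ -/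

import Mathlib

open MeasureTheory ProbabilityTheory

/-- The product σ-algebra on matrices, generated by the entries. -/
instance matrixMeasurableSpace {m n α : Type*} [MeasurableSpace α] :
    MeasurableSpace (Matrix m n α) :=
  inferInstanceAs (MeasurableSpace (m → n → α))

/-- The law of an `N × N` real Ginibre matrix: the entries are independent standard Gaussians
(a matrix is, as an element of the product space, the family of its entries). -/
noncomputable def realGinibre (N : ℕ) : Measure (Matrix (Fin N) (Fin N) ℝ) :=
  Measure.pi fun _ : Fin N => Measure.pi fun _ : Fin N => gaussianReal 0 1

/-- Lebesgue measure `(dY) = ∏ dY i j` on the `N × N` real matrices. -/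
noncomputable def matrixLebesgue (N : ℕ) : Measure (Matrix (Fin N) (Fin N) ℝ) :=
  Measure.pi fun _ : Fin N => Measure.pi fun _ : Fin N => (volume : Measure ℝ)

/-- The matrix Cauchy density. -/
noncomputable def matrixCauchyDensity (N : ℕ) (Y : Matrix (Fin N) (Fin N) ℝ) : ℝ :=
  Real.pi ^ (-((N : ℝ) ^ 2 / 2)) *
    (∏ j ∈ Finset.range N,
      Real.Gamma (((N : ℝ) + 1) / 2 + (j : ℝ) / 2) / Real.Gamma (((j : ℝ) + 1) / 2)) *
    (1 + Y * Y.transpose).det ^ (-(N : ℤ))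

open scoped ENNReal Matrix

/-! For fixed invertible `A`, the substitution `B = A * Y` has Jacobian `|det A| ^ N`. With `φ` the
Ginibre density, Tonelli gives `Y` the density `∫ |det A| ^ N φ(A) φ(A * Y) dA`. The exponents add
up to the trace of `A (1 + Y Yᵀ) Aᵀ`. Choosing `M Mᵀ = 1 + Y Yᵀ` and integrating over `G = A * M`,
the determinant weight and the Jacobian each contribute `|det M| ^ (-N)`, together `det (1 + Y Yᵀ) ^
(-N)`. What remains is a constant times `E |det G| ^ N` for a Ginibre matrix `G`
(`lintegral_fibre_eq_matrixCauchyDensity`). That moment comes from rotation invariance: turning the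
first row onto an axis gives `|det G| = ‖g‖ |det G'|` with `G'` a smaller Ginibre matrix independent
of `g` (`lintegral_abs_det_realGinibre_succ`). Iterating yields the product of Gamma quotients, and
also almost sure invertibility. -/

/-! ### Densities of product measures -/

theorem lintegral_fin_prod_eq_prod {n : ℕ} {α : Fin n → Type*} [∀ i, MeasurableSpace (α i)]
    (μ : ∀ i, Measure (α i)) [∀ i, SigmaFinite (μ i)] {f : ∀ i, α i → ℝ≥0∞}
    (hf : ∀ i, Measurable (f i)) :
    ∫⁻ x, ∏ i, f i (x i) ∂(Measure.pi μ) = ∏ i, ∫⁻ x, f i x ∂(μ i) := by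
  induction n with
  | zero => simp
  | succ n ih =>
    have hm : Measurable fun x : (j : Fin n) → α (Fin.succ j) => ∏ j, f (Fin.succ j) (x j) :=
      Finset.measurable_fun_prod _ fun i _ => (hf _).comp (measurable_pi_apply i)
    rw [← (measurePreserving_piFinSuccAbove μ 0).symm.lintegral_comp_emb
      (MeasurableEquiv.measurableEmbedding _)]
    simp_rw [MeasurableEquiv.piFinSuccAbove_symm_apply, Fin.insertNthEquiv,
      Fin.prod_univ_succ, Fin.insertNth_zero]
    simp only [Fin.zero_succAbove]
    have := lintegral_prod_mul (μ := μ 0) (ν := Measure.pi fun j : Fin n => μ j.succ)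
      (hf 0).aemeasurable hm.aemeasurable
    rw [ih (fun i => μ i.succ) (fun i => hf i.succ)] at this
    exact this

theorem pi_withDensity_fin {n : ℕ} {α : Fin n → Type*} [∀ i, MeasurableSpace (α i)]
    (μ : ∀ i, Measure (α i)) [∀ i, SigmaFinite (μ i)] {f : ∀ i, α i → ℝ≥0∞}
    (hf : ∀ i, Measurable (f i)) [∀ i, SigmaFinite ((μ i).withDensity (f i))] :
    Measure.pi (fun i => (μ i).withDensity (f i)) =
      (Measure.pi μ).withDensity fun x => ∏ i, f i (x i) := by
  refine Measure.pi_eq fun s hs => ?_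
  rw [withDensity_apply _ (MeasurableSet.univ_pi hs),
    ← lintegral_indicator (MeasurableSet.univ_pi hs)]
  have h : ∀ x : (i : Fin n) → α i,
      (Set.univ.pi s).indicator (fun x => ∏ i, f i (x i)) x =
        ∏ i, (s i).indicator (f i) (x i) := by
    intro x
    by_cases hx : x ∈ Set.univ.pi s
    · rw [Set.indicator_of_mem hx]
      exact Finset.prod_congr rfl fun i _ =>
        (Set.indicator_of_mem (hx i (Set.mem_univ i)) (f i)).symm
    · rw [Set.indicator_of_notMem hx]
      obtain ⟨i, hi⟩ : ∃ i, x i ∉ s i := by simpa [Set.mem_pi] using hx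
      exact (Finset.prod_eq_zero (Finset.mem_univ i) (Set.indicator_of_notMem hi _)).symm
  simp_rw [h]
  rw [lintegral_fin_prod_eq_prod μ fun i => (hf i).indicator (hs i)]
  exact Finset.prod_congr rfl fun i _ => by
    rw [withDensity_apply _ (hs i), lintegral_indicator (hs i)]

/-! ### Gaussian vectors and rotations -/

/-- The law of a vector of `n` independent standard Gaussians. -/
noncomputable def gaussianVector (n : ℕ) : Measure (Fin n → ℝ) :=
  Measure.pi fun _ => gaussianReal 0 1

instance (n : ℕ) : IsProbabilityMeasure (gaussianVector n) := by
  unfold gaussianVector; infer_instance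

instance (n : ℕ) : IsProbabilityMeasure (realGinibre n) :=
  inferInstanceAs (IsProbabilityMeasure (Measure.pi fun _ : Fin n => gaussianVector n))

/-- The density of a vector of `n` independent standard Gaussians. -/
noncomputable def gaussianVectorPDF (n : ℕ) (x : Fin n → ℝ) : ℝ :=
  (√(2 * Real.pi))⁻¹ ^ n * Real.exp (-(x ⬝ᵥ x) / 2)

theorem gaussianVectorPDF_nonneg (n : ℕ) (x : Fin n → ℝ) : 0 ≤ gaussianVectorPDF n x := by
  unfold gaussianVectorPDF; positivity

theorem continuous_gaussianVectorPDF (n : ℕ) : Continuous (gaussianVectorPDF n) := by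
  unfold gaussianVectorPDF dotProduct; fun_prop

theorem gaussianVector_eq_withDensity (n : ℕ) :
    gaussianVector n = volume.withDensity fun x => ENNReal.ofReal (gaussianVectorPDF n x) := by
  have h : gaussianReal 0 1 = volume.withDensity (gaussianPDF 0 1) :=
    gaussianReal_of_var_ne_zero 0 one_ne_zero
  have : SigmaFinite ((volume : Measure ℝ).withDensity (gaussianPDF 0 1)) := by
    rw [← h]; infer_instance
  rw [gaussianVector, h, pi_withDensity_fin _ fun _ => measurable_gaussianPDF 0 1]
  congr 1
  ext x
  simp only [gaussianPDF]
  rw [← ENNReal.ofReal_prod_of_nonneg fun i _ => gaussianPDFReal_nonneg _ _ _]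
  simp only [gaussianPDFReal, gaussianVectorPDF, Finset.prod_mul_distrib, ← Real.exp_sum]
  simp [dotProduct, neg_div, Finset.sum_div, sq]

/-- The density depends only on `x ⬝ᵥ x`, and `|det O| = 1` makes Lebesgue measure invariant. -/
theorem measurePreserving_mulVec_gaussianVector {n : ℕ} {O : Matrix (Fin n) (Fin n) ℝ}
    (hO : Oᵀ * O = 1) :
    MeasurePreserving (fun x => O *ᵥ x) (gaussianVector n) (gaussianVector n) := by
  have hdet : |O.det| = 1 := by
    have := congrArg Matrix.det hO
    rw [Matrix.det_mul, Matrix.det_transpose, Matrix.det_one] at this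
    rcases mul_self_eq_one_iff.1 this with h | h <;> simp [h]
  have hne : O.det ≠ 0 := by rintro h; simp [h] at hdet
  have hm : Measurable fun x : Fin n → ℝ => O *ᵥ x :=
    (Continuous.matrix_mulVec continuous_const continuous_id).measurable
  have hvol : MeasurePreserving (fun x : Fin n → ℝ => O *ᵥ x) volume volume := by
    refine ⟨hm, ?_⟩
    have := Real.map_matrix_volume_pi_eq_smul_volume_pi hne
    rw [abs_inv, hdet] at this
    rw [inv_one, ENNReal.ofReal_one, one_smul] at this
    exact this
  have hpdf : ∀ x, gaussianVectorPDF n (O *ᵥ x) = gaussianVectorPDF n x := by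
    intro x
    unfold gaussianVectorPDF
    rw [Matrix.dotProduct_mulVec, Matrix.vecMul_mulVec, hO, Matrix.vecMul_one]
  refine ⟨hm, ?_⟩
  ext s hs
  rw [Measure.map_apply hm hs, gaussianVector_eq_withDensity, withDensity_apply _ (hm hs),
    withDensity_apply _ hs, ← hvol.setLIntegral_comp_preimage hs
      (continuous_gaussianVectorPDF n).measurable.ennreal_ofReal]
  simp_rw [hpdf]

/-- A Householder reflection sends any vector to a multiple of a prescribed basis vector. -/
theorem exists_orthogonal_mulVec_eq_single {n : ℕ} (g : Fin (n + 1) → ℝ) :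
    ∃ O : Matrix (Fin (n + 1)) (Fin (n + 1)) ℝ, Oᵀ * O = 1 ∧
      O *ᵥ g = Pi.single 0 (√(g ⬝ᵥ g)) := by
  set r := √(g ⬝ᵥ g) with hr
  have hgg : 0 ≤ g ⬝ᵥ g := by
    simpa [dotProduct] using Finset.sum_nonneg fun i _ => mul_self_nonneg (g i)
  have hrr : r * r = g ⬝ᵥ g := Real.mul_self_sqrt hgg
  set e : Fin (n + 1) → ℝ := Pi.single 0 r with he
  set u := g - e with hu
  have hee : e ⬝ᵥ e = g ⬝ᵥ g := by simp [he, hrr]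
  -- If `u = 0`, then `g` already lies on the axis and there is no hyperplane to reflect in.
  by_cases h0 : u ⬝ᵥ u = 0
  · refine ⟨1, by simp, ?_⟩
    have : u = 0 := dotProduct_self_eq_zero.1 h0
    simpa [hu, sub_eq_zero] using this
  -- Since `g` and `e` have equal norm, the reflection in the hyperplane orthogonal to `u` sends `g`
  -- to `g - u = e`.
  have huu : u ⬝ᵥ u = 2 * (u ⬝ᵥ g) := by
    simp only [hu, sub_dotProduct, dotProduct_sub, hee, dotProduct_comm g e]; ring
  refine ⟨1 - (2 / (u ⬝ᵥ u)) • Matrix.vecMulVec u u, ?_, ?_⟩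
  · rw [Matrix.transpose_sub, Matrix.transpose_one, Matrix.transpose_smul,
      Matrix.transpose_vecMulVec]
    simp only [sub_mul, mul_sub, Matrix.smul_mul, Matrix.mul_smul, Matrix.vecMulVec_mul_vecMulVec,
      Matrix.mul_one, Matrix.one_mul, smul_smul, Matrix.vecMulVec_smul]
    have : 2 / (u ⬝ᵥ u) * (2 / (u ⬝ᵥ u)) * (u ⬝ᵥ u) = 2 / (u ⬝ᵥ u) + 2 / (u ⬝ᵥ u) := by
      field_simp; norm_num
    ext i j
    simp [Matrix.vecMulVec_apply]
    linear_combination (u i * u j) * this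
  · rw [Matrix.sub_mulVec, Matrix.one_mulVec, Matrix.smul_mulVec, Matrix.vecMulVec_mulVec]
    have : 2 / (u ⬝ᵥ u) * (u ⬝ᵥ g) = 1 := by
      rw [huu] at h0 ⊢; field_simp
      exact div_self (by rintro h; simp [h] at h0)
    ext i
    simp
    rw [← mul_assoc, this]
    simp [hu]

/-! ### Determinant of a Ginibre matrix -/

theorem measurable_matrix_of_continuous {m n : ℕ} {α : Type*} [TopologicalSpace α]
    [MeasurableSpace α] [BorelSpace α] {F : Matrix (Fin m) (Fin n) ℝ → α} (hF : Continuous F) :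
    Measurable F :=
  Continuous.measurable (α := Fin m → Fin n → ℝ) hF

theorem det_cons_single {n : ℕ} (r : ℝ) (R : Fin n → Fin (n + 1) → ℝ) :
    (Matrix.of (Fin.cons (Pi.single 0 r) R : Fin (n + 1) → Fin (n + 1) → ℝ)).det =
      r * (Matrix.of fun i j => R i (Fin.succ j)).det := by
  rw [Matrix.det_succ_row_zero, Fin.sum_univ_succ, Finset.sum_eq_zero]
  · simp only [Matrix.of_apply, Fin.cons_zero, Pi.single_eq_same, Fin.val_zero, pow_zero, one_mul,
      Fin.succAbove_zero, add_zero]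
    rfl
  · intro j _
    simp

/-- The law of the determinant of a Ginibre matrix: rotating the first row onto a coordinate axis
splits off an independent factor distributed as the norm of a Gaussian vector. -/
theorem lintegral_abs_det_realGinibre_succ (n : ℕ) {f : ℝ → ℝ≥0∞} (hf : Measurable f) :
    ∫⁻ G, f |G.det| ∂(realGinibre (n + 1)) =
      ∫⁻ g, ∫⁻ G, f (√(g ⬝ᵥ g) * |G.det|) ∂(realGinibre n) ∂(gaussianVector (n + 1)) := by
  have hcons : Continuous fun p : (Fin (n + 1) → ℝ) × (Fin n → Fin (n + 1) → ℝ) =>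
      (Matrix.of (Fin.cons p.1 p.2 : Fin (n + 1) → Fin (n + 1) → ℝ)) := by
    refine continuous_pi fun i => ?_
    refine Fin.cases ?_ (fun i => ?_) i
    · exact continuous_fst
    · exact (continuous_apply i).comp continuous_snd
  have hmeas : Measurable fun p : (Fin (n + 1) → ℝ) × (Fin n → Fin (n + 1) → ℝ) =>
      f |(Matrix.of (Fin.cons p.1 p.2 : Fin (n + 1) → Fin (n + 1) → ℝ)).det| :=
    hf.comp hcons.matrix_det.abs.measurable
  have hsplit : ∫⁻ G, f |G.det| ∂(realGinibre (n + 1)) =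
      ∫⁻ p, f |(Matrix.of (Fin.cons p.1 p.2 : Fin (n + 1) → Fin (n + 1) → ℝ)).det|
        ∂((gaussianVector (n + 1)).prod
          (Measure.pi fun _ : Fin n => gaussianVector (n + 1))) := by
    have h := (measurePreserving_piFinSuccAbove
      (fun _ : Fin (n + 1) => gaussianVector (n + 1)) 0).symm.lintegral_comp_emb
        (MeasurableEquiv.measurableEmbedding _) (fun G => f |(Matrix.of G).det|)
    simp only [MeasurableEquiv.piFinSuccAbove_symm_apply, Fin.insertNthEquiv_zero] at h
    exact h.symm
  rw [hsplit, lintegral_prod _ hmeas.aemeasurable]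
  refine lintegral_congr fun g => ?_
  obtain ⟨O, hO, hOg⟩ := exists_orthogonal_mulVec_eq_single g
  have hdet : |O.det| = 1 := by
    have := congrArg Matrix.det hO
    rw [Matrix.det_mul, Matrix.det_transpose, Matrix.det_one] at this
    rcases mul_self_eq_one_iff.1 this with h | h <;> simp [h]
  -- Rotating every row by `O` is right multiplication by `Oᵀ`, which keeps `|det|`; the first row
  -- is then supported at index `0`.
  have hrot : ∀ R : Fin n → Fin (n + 1) → ℝ,
      |(Matrix.of (Fin.cons g R : Fin (n + 1) → Fin (n + 1) → ℝ)).det| =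
        √(g ⬝ᵥ g) * |(Matrix.of fun i j => (O *ᵥ R i) (Fin.succ j)).det| := by
    intro R
    have h1 : (Matrix.of (Fin.cons g R : Fin (n + 1) → Fin (n + 1) → ℝ)) * Oᵀ =
        Matrix.of (Fin.cons (Pi.single 0 √(g ⬝ᵥ g)) (fun i => O *ᵥ R i) :
          Fin (n + 1) → Fin (n + 1) → ℝ) := by
      rw [← hOg]
      ext i j
      refine Fin.cases ?_ (fun i => ?_) i <;>
        simp [Matrix.mul_apply, Matrix.mulVec, dotProduct, mul_comm]
    have h2 := congrArg (fun M => |Matrix.det M|) h1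
    simp only [Matrix.det_mul, Matrix.det_transpose, abs_mul, hdet, mul_one,
      det_cons_single, abs_of_nonneg (Real.sqrt_nonneg _)] at h2
    exact h2
  simp_rw [hrot]
  -- `O` depends on `g` alone, so with `g` fixed the rotated remaining rows are still independent
  -- Gaussians, as are their truncations.
  have htail : MeasurePreserving (fun x : Fin (n + 1) → ℝ => fun j : Fin n => x j.succ)
      (gaussianVector (n + 1)) (gaussianVector n) :=
    measurePreserving_snd.comp
      (measurePreserving_piFinSuccAbove (fun _ : Fin (n + 1) => gaussianReal 0 1) 0)
  have hmp := measurePreserving_pi (fun _ : Fin n => gaussianVector (n + 1))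
    (fun _ : Fin n => gaussianVector n)
    fun _ => htail.comp (measurePreserving_mulVec_gaussianVector hO)
  have hm2 : Measurable fun G : Fin n → Fin n → ℝ => f (√(g ⬝ᵥ g) * |(Matrix.of G).det|) :=
    hf.comp (Continuous.measurable (by fun_prop))
  exact hmp.lintegral_comp hm2

theorem ae_det_ne_zero_realGinibre (n : ℕ) : ∀ᵐ G ∂(realGinibre n), G.det ≠ 0 := by
  induction n with
  | zero => simp
  | succ n ih =>
    -- With this test function the recursion computes the probability that the determinant vanishes.
    have hf : Measurable (Set.indicator {0} (1 : ℝ → ℝ≥0∞)) :=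
      measurable_one.indicator (measurableSet_singleton 0)
    have hmd : Measurable fun G : Matrix (Fin (n + 1)) (Fin (n + 1)) ℝ => |G.det| :=
      measurable_matrix_of_continuous (by fun_prop)
    have hfd : Measurable fun G : Matrix (Fin (n + 1)) (Fin (n + 1)) ℝ =>
        Set.indicator {0} (1 : ℝ → ℝ≥0∞) |G.det| := hf.comp hmd
    have h := lintegral_abs_det_realGinibre_succ n hf
    have hz : ∫⁻ g, ∫⁻ G, Set.indicator {0} (1 : ℝ → ℝ≥0∞) (√(g ⬝ᵥ g) * |G.det|)
        ∂(realGinibre n) ∂(gaussianVector (n + 1)) = 0 := by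
      have hg : ∀ᵐ g ∂(gaussianVector (n + 1)), g ≠ 0 := by
        rw [gaussianVector_eq_withDensity]
        exact (withDensity_absolutelyContinuous _ _).ae_le (Measure.ae_ne volume 0)
      refine (lintegral_congr_ae ?_).trans lintegral_zero
      filter_upwards [hg] with g hg
      refine (lintegral_congr_ae ?_).trans lintegral_zero
      filter_upwards [ih] with G hG
      have hgg : 0 < √(g ⬝ᵥ g) := by
        refine Real.sqrt_pos.2 (lt_of_le_of_ne ?_ ?_)
        · simpa [dotProduct] using Finset.sum_nonneg fun i _ => mul_self_nonneg (g i)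
        · exact fun h => hg (dotProduct_self_eq_zero.1 h.symm)
      exact Set.indicator_of_notMem (by simp [hgg.ne', hG]) _
    rw [hz, lintegral_eq_zero_iff hfd] at h
    filter_upwards [h] with G hG h0
    simp [h0] at hG

/-- Polar coordinates reduce every moment to a Gamma integral times one common constant, which
cancels on dividing by the zeroth moment. -/
theorem lintegral_norm_pow_gaussianVector (n N : ℕ) :
    ∫⁻ g, ENNReal.ofReal (√(g ⬝ᵥ g) ^ N) ∂(gaussianVector (n + 1)) =
      ENNReal.ofReal (2 ^ ((N : ℝ) / 2) * Real.Gamma (((n : ℝ) + 1 + N) / 2) /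
        Real.Gamma (((n : ℝ) + 1) / 2)) := by
  let E := EuclideanSpace ℝ (Fin (n + 1))
  set c : ℝ := (√(2 * Real.pi))⁻¹ ^ (n + 1) with hc
  set K : ℝ := Module.finrank ℝ E * (volume : Measure E).real (Metric.ball 0 1) with hK
  have hradial : ∀ M : ℕ, ∫⁻ g, ENNReal.ofReal (√(g ⬝ᵥ g) ^ M) ∂(gaussianVector (n + 1)) =
      ENNReal.ofReal (K * c * (2 ^ (((n : ℝ) + 1 + M) / 2) * (1 / 2) *
        Real.Gamma (((n : ℝ) + 1 + M) / 2))) := by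
    intro M
    let F : ℝ → ℝ := fun r => r ^ M * (c * Real.exp (-(r ^ 2) / 2))
    have hpow : ∀ y ∈ Set.Ioi (0 : ℝ), y ^ (Module.finrank ℝ E - 1) • F y =
        c * (y ^ ((n : ℝ) + M) * Real.exp (-(1 / 2) * y ^ (2 : ℝ))) := by
      intro y hy
      rw [Real.rpow_two, ← Nat.cast_add, Real.rpow_natCast, pow_add]
      simp only [E, F, finrank_euclideanSpace_fin, Nat.add_sub_cancel, smul_eq_mul]
      ring_nf
    have hval := integral_rpow_mul_exp_neg_mul_rpow (p := 2) (q := (n : ℝ) + M) (b := 1 / 2)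
      (by norm_num) (by have : (0 : ℝ) ≤ (n : ℝ) + M := by positivity
                        linarith) (by norm_num)
    have hint : Integrable (fun x : E => F ‖x‖) volume := by
      rw [integrable_fun_norm_addHaar volume (f := F), integrableOn_congr_fun hpow
        measurableSet_Ioi]
      exact (integrableOn_rpow_mul_exp_neg_mul_rpow (by
        have : (0 : ℝ) ≤ (n : ℝ) + M := by positivity
        linarith) (by norm_num) (by norm_num)).const_mul _
    have hInt : ∫ x : E, F ‖x‖ = K * c * (2 ^ (((n : ℝ) + 1 + M) / 2) * (1 / 2) *
        Real.Gamma (((n : ℝ) + 1 + M) / 2)) := by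
      rw [integral_fun_norm_addHaar, setIntegral_congr_fun measurableSet_Ioi hpow,
        integral_const_mul, hval, nsmul_eq_mul, smul_eq_mul, hK]
      rw [one_div, Real.inv_rpow (by norm_num), neg_div, Real.rpow_neg (by norm_num), inv_inv,
        add_right_comm]
      ring
    rw [← hInt, ofReal_integral_eq_lintegral_ofReal hint (.of_forall fun x => by positivity),
      gaussianVector_eq_withDensity,
      lintegral_withDensity_eq_lintegral_mul _
        (continuous_gaussianVectorPDF _).measurable.ennreal_ofReal
        (Continuous.measurable (by unfold dotProduct; fun_prop)).ennreal_ofReal,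
      ← (PiLp.volume_preserving_toLp (Fin (n + 1))).lintegral_comp_emb
        (MeasurableEquiv.toLp 2 _).measurableEmbedding]
    refine lintegral_congr fun x => ?_
    have hx : x ⬝ᵥ x = ‖WithLp.toLp 2 x‖ ^ 2 := by
      rw [EuclideanSpace.real_norm_sq_eq]
      simp [dotProduct, sq]
    rw [Pi.mul_apply, ← ENNReal.ofReal_mul (gaussianVectorPDF_nonneg _ _), gaussianVectorPDF, hx,
      Real.sqrt_sq (norm_nonneg _), mul_comm]
  -- The zeroth moment is the total mass `1`; this fixes `K * c` without computing the volume of the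
  -- unit ball.
  have h0 := hradial 0
  have h1 : K * c * (2 ^ (((n : ℝ) + 1) / 2) * (1 / 2) * Real.Gamma (((n : ℝ) + 1) / 2)) = 1 := by
    simp only [pow_zero, ENNReal.ofReal_one, lintegral_const, measure_univ, mul_one,
      Nat.cast_zero, add_zero] at h0
    exact ENNReal.ofReal_eq_one.1 h0.symm
  have hG : Real.Gamma (((n : ℝ) + 1) / 2) ≠ 0 := (Real.Gamma_pos_of_pos (by positivity)).ne'
  rw [hradial N]
  congr 1
  rw [eq_div_iff hG, add_div _ (N : ℝ) 2, Real.rpow_add (by norm_num)]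
  linear_combination (2 ^ ((N : ℝ) / 2) * Real.Gamma (((n : ℝ) + 1)/2 + N / 2)) * h1

theorem lintegral_abs_det_pow_realGinibre (n N : ℕ) :
    ∫⁻ G, ENNReal.ofReal (|G.det| ^ N) ∂(realGinibre n) =
      ENNReal.ofReal (∏ j ∈ Finset.range n, (2 ^ ((N : ℝ) / 2) *
        Real.Gamma (((j : ℝ) + 1 + N) / 2) / Real.Gamma (((j : ℝ) + 1) / 2))) := by
  induction n with
  | zero => simp
  | succ n ih =>
    have hf : Measurable fun x : ℝ => ENNReal.ofReal (x ^ N) := by fun_prop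
    rw [lintegral_abs_det_realGinibre_succ n hf]
    have hmd : Measurable fun G : Matrix (Fin n) (Fin n) ℝ => ENNReal.ofReal (|G.det| ^ N) :=
      (measurable_matrix_of_continuous (by fun_prop)).ennreal_ofReal
    simp_rw [mul_pow, ENNReal.ofReal_mul (pow_nonneg (Real.sqrt_nonneg _) N)]
    simp_rw [lintegral_const_mul _ hmd, ih]
    rw [lintegral_mul_const _
      (Continuous.measurable (by unfold dotProduct; fun_prop)).ennreal_ofReal,
      lintegral_norm_pow_gaussianVector, Finset.prod_range_succ, mul_comm, ENNReal.ofReal_mul]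
    refine Finset.prod_nonneg fun j _ => ?_
    have h1 := Real.Gamma_pos_of_pos (s := ((j : ℝ) + 1 + N) / 2) (by positivity)
    have h2 := Real.Gamma_pos_of_pos (s := ((j : ℝ) + 1) / 2) (by positivity)
    positivity

/-! ### Linear changes of variables on matrices -/

/-- Right multiplication acts on each of the `n` rows separately through `Mᵀ`, so its determinant is
`M.det ^ n`. -/
theorem map_mul_right_matrixLebesgue {n : ℕ} {M : Matrix (Fin n) (Fin n) ℝ} (hM : M.det ≠ 0) :
    (matrixLebesgue n).map (fun A => A * M) =
      ENNReal.ofReal ((|M.det|⁻¹) ^ n) • matrixLebesgue n := by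
  let f : (Fin n → ℝ) →ₗ[ℝ] (Fin n → ℝ) := Matrix.toLin' Mᵀ
  let F : (Fin n → Fin n → ℝ) →ₗ[ℝ] (Fin n → Fin n → ℝ) :=
    LinearMap.pi fun i => f.comp (LinearMap.proj i)
  have hdet : LinearMap.det F = M.det ^ n := by
    simp only [F, LinearMap.det_pi, f, LinearMap.det_toLin', Matrix.det_transpose,
      Finset.prod_const, Finset.card_univ, Fintype.card_fin]
  have h := Measure.map_linearMap_addHaar_eq_smul_addHaar
    (volume : Measure (Fin n → Fin n → ℝ)) (f := F) (by rw [hdet]; exact pow_ne_zero _ hM)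
  rw [hdet, abs_inv, abs_pow, ← inv_pow] at h
  have hF : (fun A : Matrix (Fin n) (Fin n) ℝ => A * M) = F := by
    ext A i j
    change (A * M) i j = (Mᵀ *ᵥ A i) j
    simp [Matrix.mul_apply, Matrix.mulVec, dotProduct, mul_comm]
  rw [hF]
  exact h

theorem measurePreserving_transpose_matrixLebesgue (n : ℕ) :
    MeasurePreserving (fun A => Aᵀ) (matrixLebesgue n) (matrixLebesgue n) := by
  let F : (Fin n → Fin n → ℝ) →ₗ[ℝ] (Fin n → Fin n → ℝ) :=
    (Matrix.transposeLinearEquiv (Fin n) (Fin n) ℝ ℝ).toLinearMap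
  have hdet : |LinearMap.det F| = 1 := by
    -- An involution has determinant `±1`.
    have h : F * F = 1 := by ext; rfl
    have := congrArg LinearMap.det h
    rw [map_mul, map_one] at this
    rcases mul_self_eq_one_iff.1 this with h | h <;> simp [h]
  have h := Measure.map_linearMap_addHaar_eq_smul_addHaar
    (volume : Measure (Fin n → Fin n → ℝ)) (f := F) (by rintro h; simp [h] at hdet)
  rw [abs_inv, hdet, inv_one, ENNReal.ofReal_one, one_smul] at h
  exact ⟨measurable_matrix_of_continuous (m := n) (n := n) (α := Fin n → Fin n → ℝ)
    (Continuous.matrix_transpose continuous_id), h⟩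

theorem measurable_mul_right {n : ℕ} (M : Matrix (Fin n) (Fin n) ℝ) :
    Measurable fun A : Matrix (Fin n) (Fin n) ℝ => A * M :=
  measurable_matrix_of_continuous (m := n) (n := n) (α := Fin n → Fin n → ℝ)
    (Continuous.matrix_mul continuous_id continuous_const)

theorem measurable_mul_left {n : ℕ} (M : Matrix (Fin n) (Fin n) ℝ) :
    Measurable fun A : Matrix (Fin n) (Fin n) ℝ => M * A :=
  measurable_matrix_of_continuous (m := n) (n := n) (α := Fin n → Fin n → ℝ)
    (Continuous.matrix_mul continuous_const continuous_id)

theorem lintegral_mul_right_matrixLebesgue {n : ℕ} {M : Matrix (Fin n) (Fin n) ℝ}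
    (hM : M.det ≠ 0) {h : Matrix (Fin n) (Fin n) ℝ → ℝ≥0∞} (hh : Measurable h) :
    ∫⁻ A, h (A * M) ∂(matrixLebesgue n) =
      ENNReal.ofReal ((|M.det|⁻¹) ^ n) * ∫⁻ A, h A ∂(matrixLebesgue n) := by
  rw [← lintegral_map hh (measurable_mul_right M), map_mul_right_matrixLebesgue hM,
    lintegral_smul_measure, smul_eq_mul]

theorem lintegral_mul_left_matrixLebesgue {n : ℕ} {M : Matrix (Fin n) (Fin n) ℝ}
    (hM : M.det ≠ 0) {h : Matrix (Fin n) (Fin n) ℝ → ℝ≥0∞} (hh : Measurable h) :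
    ∫⁻ A, h (M * A) ∂(matrixLebesgue n) =
      ENNReal.ofReal ((|M.det|⁻¹) ^ n) * ∫⁻ A, h A ∂(matrixLebesgue n) := by
  have ht := measurePreserving_transpose_matrixLebesgue n
  have hM' : Mᵀ.det ≠ 0 := by rwa [Matrix.det_transpose]
  have h1 := lintegral_mul_right_matrixLebesgue hM' (hh.comp ht.measurable)
  have hML : Measurable fun A => h (M * A) := hh.comp (measurable_mul_left M)
  rw [← ht.lintegral_comp hh, ← ht.lintegral_comp hML]
  simpa [Function.comp_def, Matrix.transpose_mul] using h1

/-! ### Ginibre density and the fibre integral -/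

/-- The density of a real Ginibre matrix. -/
noncomputable def ginibrePDF (n : ℕ) (A : Matrix (Fin n) (Fin n) ℝ) : ℝ :=
  (√(2 * Real.pi))⁻¹ ^ n ^ 2 * Real.exp (-(A * Aᵀ).trace / 2)

theorem ginibrePDF_nonneg (n : ℕ) (A : Matrix (Fin n) (Fin n) ℝ) : 0 ≤ ginibrePDF n A := by
  unfold ginibrePDF; positivity

theorem continuous_ginibrePDF (n : ℕ) : Continuous (ginibrePDF n) := by
  unfold ginibrePDF; fun_prop

theorem measurable_ginibrePDF (n : ℕ) : Measurable (ginibrePDF n) :=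
  measurable_matrix_of_continuous (continuous_ginibrePDF n)

theorem realGinibre_eq_withDensity (n : ℕ) :
    realGinibre n = (matrixLebesgue n).withDensity fun A => ENNReal.ofReal (ginibrePDF n A) := by
  have h := gaussianVector_eq_withDensity n
  have : SigmaFinite ((volume : Measure (Fin n → ℝ)).withDensity
      fun x => ENNReal.ofReal (gaussianVectorPDF n x)) := by
    rw [← h]; infer_instance
  have h2 := pi_withDensity_fin (fun _ : Fin n => (volume : Measure (Fin n → ℝ)))
    (fun _ => (continuous_gaussianVectorPDF n).measurable.ennreal_ofReal)
  rw [← h] at h2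
  have h3 : (fun x : Fin n → Fin n → ℝ => ∏ i, ENNReal.ofReal (gaussianVectorPDF n (x i))) =
      fun A => ENNReal.ofReal (ginibrePDF n A) := by
    ext x
    rw [← ENNReal.ofReal_prod_of_nonneg fun i _ => gaussianVectorPDF_nonneg _ _]
    have htr : (Matrix.of x * (Matrix.of x)ᵀ).trace = ∑ i, x i ⬝ᵥ x i := rfl
    change _ = ENNReal.ofReal (ginibrePDF n (Matrix.of x))
    simp only [gaussianVectorPDF, ginibrePDF, htr, Finset.prod_mul_distrib, ← Real.exp_sum,
      Finset.prod_const, Finset.card_univ, Fintype.card_fin, ← pow_mul, sq, neg_div,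
      Finset.sum_neg_distrib, Finset.sum_div]
  rw [h3] at h2
  exact h2

theorem lintegral_realGinibre {n : ℕ} {h : Matrix (Fin n) (Fin n) ℝ → ℝ≥0∞} (hh : Measurable h) :
    ∫⁻ A, h A ∂(realGinibre n) =
      ∫⁻ A, ENNReal.ofReal (ginibrePDF n A) * h A ∂(matrixLebesgue n) := by
  rw [realGinibre_eq_withDensity,
    lintegral_withDensity_eq_lintegral_mul _ (measurable_ginibrePDF n).ennreal_ofReal hh]
  rfl

theorem ginibrePDF_mul_ginibrePDF {n : ℕ} {A Y M : Matrix (Fin n) (Fin n) ℝ}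
    (hM : M * Mᵀ = 1 + Y * Yᵀ) :
    ginibrePDF n A * ginibrePDF n (A * Y) =
      (√(2 * Real.pi))⁻¹ ^ n ^ 2 * ginibrePDF n (A * M) := by
  have : A * M * (A * M)ᵀ = A * Aᵀ + A * Y * (A * Y)ᵀ := by
    rw [Matrix.transpose_mul, ← Matrix.mul_assoc, Matrix.mul_assoc A M, hM, Matrix.transpose_mul,
      Matrix.mul_add, Matrix.mul_one, Matrix.add_mul]
    simp only [Matrix.mul_assoc]
  simp only [ginibrePDF, this, Matrix.trace_add]
  rw [neg_add, add_div, Real.exp_add]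
  ring

/-- `1 + Y * Yᵀ` is positive definite, hence of the form `star B * B`; take `M = Bᵀ`. -/
theorem exists_mul_transpose_eq_one_add {n : ℕ} (Y : Matrix (Fin n) (Fin n) ℝ) :
    ∃ M : Matrix (Fin n) (Fin n) ℝ, M * Mᵀ = 1 + Y * Yᵀ ∧ M.det ≠ 0 := by
  have hpd : (1 + Y * Yᵀ).PosDef := by
    have := Matrix.posSemidef_self_mul_conjTranspose Y
    rw [Matrix.conjTranspose_eq_transpose_of_trivial] at this
    exact Matrix.PosDef.one.add_posSemidef this
  obtain ⟨B, hB⟩ := by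
    open scoped MatrixOrder Matrix.Norms.L2Operator in
    exact CStarAlgebra.nonneg_iff_eq_star_mul_self.mp hpd.posSemidef.nonneg
  have hB' : Bᵀ * Bᵀᵀ = 1 + Y * Yᵀ := by
    rw [hB, Matrix.star_eq_conjTranspose, Matrix.conjTranspose_eq_transpose_of_trivial,
      Matrix.transpose_transpose]
  refine ⟨Bᵀ, hB', fun h => hpd.det_pos.ne' ?_⟩
  rw [← hB', Matrix.det_mul, h, zero_mul]

/-- The total mass of the fibre over `Y` in the change of variables `(A, B) ↦ (A, A⁻¹ * B)`. -/
theorem lintegral_fibre_eq_matrixCauchyDensity {n : ℕ} (Y : Matrix (Fin n) (Fin n) ℝ) :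
    ∫⁻ A, ENNReal.ofReal (|A.det| ^ n * (ginibrePDF n A * ginibrePDF n (A * Y)))
        ∂(matrixLebesgue n) = ENNReal.ofReal (matrixCauchyDensity n Y) := by
  obtain ⟨M, hM, hdet⟩ := exists_mul_transpose_eq_one_add Y
  have hm : 0 < |M.det| := abs_pos.2 hdet
  have hmeasDet : Measurable fun A : Matrix (Fin n) (Fin n) ℝ => |A.det| ^ n :=
    measurable_matrix_of_continuous (by fun_prop)
  set c : ℝ := (√(2 * Real.pi))⁻¹ ^ n ^ 2 with hc
  have hc0 : 0 ≤ c := by positivity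
  have h1 : ∀ A : Matrix (Fin n) (Fin n) ℝ,
      ENNReal.ofReal (|A.det| ^ n * (ginibrePDF n A * ginibrePDF n (A * Y))) =
        ENNReal.ofReal ((|M.det|⁻¹) ^ n * c) * (ENNReal.ofReal (ginibrePDF n (A * M)) *
          ENNReal.ofReal (|(A * M).det| ^ n)) := by
    intro A
    rw [ginibrePDF_mul_ginibrePDF hM, ← ENNReal.ofReal_mul (ginibrePDF_nonneg _ _),
      ← ENNReal.ofReal_mul (by positivity), Matrix.det_mul, abs_mul, mul_pow, ← hc]
    have : |M.det|⁻¹ ^ n * |M.det| ^ n = 1 := by rw [← mul_pow, inv_mul_cancel₀ hm.ne', one_pow]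
    congr 1
    linear_combination (-(|A.det| ^ n * c * ginibrePDF n (A * M))) * this
  simp_rw [h1]
  have hmeas : Measurable fun G : Matrix (Fin n) (Fin n) ℝ =>
      ENNReal.ofReal (ginibrePDF n G) * ENNReal.ofReal (|G.det| ^ n) :=
    (measurable_ginibrePDF n).ennreal_ofReal.mul hmeasDet.ennreal_ofReal
  have hmeasM : Measurable fun A : Matrix (Fin n) (Fin n) ℝ =>
      ENNReal.ofReal (ginibrePDF n (A * M)) * ENNReal.ofReal (|(A * M).det| ^ n) :=
    hmeas.comp (measurable_mul_right M)
  rw [lintegral_const_mul _ hmeasM,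
    lintegral_mul_right_matrixLebesgue hdet hmeas,
    ← lintegral_realGinibre hmeasDet.ennreal_ofReal, lintegral_abs_det_pow_realGinibre,
    ← ENNReal.ofReal_mul (by positivity), ← ENNReal.ofReal_mul (by positivity)]
  congr 1
  have hdetS : (1 + Y * Yᵀ).det = |M.det| ^ 2 := by
    rw [← hM, Matrix.det_mul, Matrix.det_transpose, sq_abs, sq]
  -- The `2 ^ (n / 2)` from each of the `n` norm moments cancels the powers of `2` in `(2π) ^ (-n² /
  -- 2)`.
  have hcpi : c * ∏ _j ∈ Finset.range n, (2 : ℝ) ^ ((n : ℝ) / 2) =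
      Real.pi ^ (-((n : ℝ) ^ 2 / 2)) := by
    rw [Finset.prod_const, Finset.card_range, ← Real.rpow_natCast (2 ^ ((n : ℝ) / 2)),
      ← Real.rpow_mul (by norm_num), hc, ← Real.rpow_natCast, Real.sqrt_eq_rpow,
      ← Real.rpow_neg (by positivity), ← Real.rpow_mul (by positivity),
      Real.mul_rpow (by norm_num) (by positivity), mul_right_comm, ← Real.rpow_add (by norm_num)]
    push_cast
    rw [show -(1 / 2) * (n : ℝ) ^ 2 + n / 2 * n = 0 by ring, Real.rpow_zero, one_mul]
    congr 1
    ring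
  have hprod : (∏ j ∈ Finset.range n, (2 ^ ((n : ℝ) / 2) *
      Real.Gamma (((j : ℝ) + 1 + n) / 2) / Real.Gamma (((j : ℝ) + 1) / 2))) =
      (∏ _j ∈ Finset.range n, (2 : ℝ) ^ ((n : ℝ) / 2)) * ∏ j ∈ Finset.range n,
        Real.Gamma (((n : ℝ) + 1) / 2 + (j : ℝ) / 2) / Real.Gamma (((j : ℝ) + 1) / 2) := by
    rw [← Finset.prod_mul_distrib]
    refine Finset.prod_congr rfl fun j _ => ?_
    rw [mul_div_assoc, show ((j : ℝ) + 1 + n) / 2 = ((n : ℝ) + 1) / 2 + (j : ℝ) / 2 by ring]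
  rw [hprod, matrixCauchyDensity, hdetS, ← hcpi, zpow_neg, zpow_natCast, inv_pow, ← pow_mul,
    mul_comm 2 n, pow_mul, sq]
  field_simp

/-! ### The law of the quotient -/

theorem measurable_inv_mul (n : ℕ) :
    Measurable fun p : Matrix (Fin n) (Fin n) ℝ × Matrix (Fin n) (Fin n) ℝ => p.1⁻¹ * p.2 := by
  have h1 : Measurable fun A : Matrix (Fin n) (Fin n) ℝ => A.det :=
    measurable_matrix_of_continuous (by fun_prop)
  have h2 : ∀ i j, Measurable fun A : Matrix (Fin n) (Fin n) ℝ => A.adjugate i j := fun i j =>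
    measurable_matrix_of_continuous
      ((Continuous.matrix_adjugate continuous_id).matrix_elem i j)
  have h3 : ∀ i j, Measurable fun A : Matrix (Fin n) (Fin n) ℝ => A i j := fun i j =>
    measurable_matrix_of_continuous (continuous_id.matrix_elem i j)
  refine measurable_pi_iff.2 fun i => measurable_pi_iff.2 fun j => ?_
  simp only [Matrix.mul_apply, Matrix.inv_def, Ring.inverse_eq_inv', Matrix.smul_apply, smul_eq_mul]
  exact Finset.measurable_fun_sum _ fun k _ =>
    ((h1.inv.mul (h2 i k)).comp measurable_fst).mul ((h3 k j).comp measurable_snd)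

instance (n : ℕ) : SigmaFinite (matrixLebesgue n) :=
  inferInstanceAs (SigmaFinite (volume : Measure (Fin n → Fin n → ℝ)))

theorem map_inv_mul_realGinibre (n : ℕ) :
    ((realGinibre n).prod (realGinibre n)).map (fun p => p.1⁻¹ * p.2) =
      (matrixLebesgue n).withDensity fun Y => ENNReal.ofReal (matrixCauchyDensity n Y) := by
  ext s hs
  set f : Matrix (Fin n) (Fin n) ℝ → ℝ≥0∞ := s.indicator 1 with hf
  have hfm : Measurable f := measurable_one.indicator hs
  have hfq : Measurable fun p : Matrix (Fin n) (Fin n) ℝ × Matrix (Fin n) (Fin n) ℝ =>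
      f (p.1⁻¹ * p.2) := hfm.comp (measurable_inv_mul n)
  rw [withDensity_apply _ hs, ← lintegral_indicator_one hs,
    lintegral_map hfm (measurable_inv_mul n),
    lintegral_prod _ hfq.aemeasurable]
  have hdetm : Measurable fun A : Matrix (Fin n) (Fin n) ℝ => |A.det| ^ n :=
    measurable_matrix_of_continuous (by fun_prop)
  have hmulm : Measurable fun p : Matrix (Fin n) (Fin n) ℝ × Matrix (Fin n) (Fin n) ℝ =>
      p.1 * p.2 :=
    Continuous.measurable (α := (Fin n → Fin n → ℝ) × (Fin n → Fin n → ℝ))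
      (γ := Fin n → Fin n → ℝ) (Continuous.matrix_mul continuous_fst continuous_snd)
  have hinner : ∀ A : Matrix (Fin n) (Fin n) ℝ, A.det ≠ 0 →
      ∫⁻ B, f (A⁻¹ * B) ∂(realGinibre n) = ENNReal.ofReal (|A.det| ^ n) *
        ∫⁻ Y, ENNReal.ofReal (ginibrePDF n (A * Y)) * f Y ∂(matrixLebesgue n) := by
    intro A hA
    have hu : IsUnit A.det := isUnit_iff_ne_zero.2 hA
    have hm : Measurable fun B : Matrix (Fin n) (Fin n) ℝ =>
        ENNReal.ofReal (ginibrePDF n B) * f (A⁻¹ * B) :=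
      (measurable_ginibrePDF n).ennreal_ofReal.mul (hfm.comp (measurable_mul_left _))
    -- This is the substitution `B = A * Y`, under which `A⁻¹ * B` becomes `Y`.
    have h := lintegral_mul_left_matrixLebesgue hA hm
    simp only [← Matrix.mul_assoc, Matrix.nonsing_inv_mul A hu, Matrix.one_mul] at h
    have hfA : Measurable fun B => f (A⁻¹ * B) := hfm.comp (measurable_mul_left _)
    rw [h, lintegral_realGinibre hfA, ← mul_assoc,
      ← ENNReal.ofReal_mul (by positivity), ← mul_pow, mul_inv_cancel₀ (abs_pos.2 hA).ne', one_pow,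
      ENNReal.ofReal_one, one_mul]
  have hdet1 : Measurable fun p : Matrix (Fin n) (Fin n) ℝ × Matrix (Fin n) (Fin n) ℝ =>
      |p.1.det| ^ n := hdetm.comp measurable_fst
  have hg1 : Measurable fun p : Matrix (Fin n) (Fin n) ℝ × Matrix (Fin n) (Fin n) ℝ =>
      ginibrePDF n p.1 := (measurable_ginibrePDF n).comp measurable_fst
  have hg2 : Measurable fun p : Matrix (Fin n) (Fin n) ℝ × Matrix (Fin n) (Fin n) ℝ =>
      ginibrePDF n (p.1 * p.2) := (measurable_ginibrePDF n).comp hmulm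
  have hpm : Measurable fun p : Matrix (Fin n) (Fin n) ℝ × Matrix (Fin n) (Fin n) ℝ =>
      ENNReal.ofReal (|p.1.det| ^ n * (ginibrePDF n p.1 * ginibrePDF n (p.1 * p.2))) :=
    (hdet1.mul (hg1.mul hg2)).ennreal_ofReal
  have hqm : Measurable fun p : Matrix (Fin n) (Fin n) ℝ × Matrix (Fin n) (Fin n) ℝ =>
      ENNReal.ofReal (ginibrePDF n (p.1 * p.2)) * f p.2 :=
    hg2.ennreal_ofReal.mul (hfm.comp measurable_snd)
  have hq1 (A : Matrix (Fin n) (Fin n) ℝ) : Measurable fun Y : Matrix (Fin n) (Fin n) ℝ =>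
      ENNReal.ofReal (ginibrePDF n (A * Y)) * f Y :=
    ((measurable_ginibrePDF n).comp (measurable_mul_left A)).ennreal_ofReal.mul hfm
  have hqi : Measurable fun A : Matrix (Fin n) (Fin n) ℝ =>
      ∫⁻ Y, ENNReal.ofReal (ginibrePDF n (A * Y)) * f Y ∂(matrixLebesgue n) :=
    hqm.lintegral_prod_right'
  have hqa : Measurable fun A : Matrix (Fin n) (Fin n) ℝ => ENNReal.ofReal (|A.det| ^ n) *
      ∫⁻ Y, ENNReal.ofReal (ginibrePDF n (A * Y)) * f Y ∂(matrixLebesgue n) :=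
    hdetm.ennreal_ofReal.mul hqi
  have hp1 (Y : Matrix (Fin n) (Fin n) ℝ) : Measurable fun A : Matrix (Fin n) (Fin n) ℝ =>
      ENNReal.ofReal (|A.det| ^ n * (ginibrePDF n A * ginibrePDF n (A * Y))) :=
    (hdetm.mul ((measurable_ginibrePDF n).mul
      ((measurable_ginibrePDF n).comp (measurable_mul_right Y)))).ennreal_ofReal
  calc ∫⁻ A, ∫⁻ B, f (A⁻¹ * B) ∂(realGinibre n) ∂(realGinibre n)
      = ∫⁻ A, ENNReal.ofReal (|A.det| ^ n) *
          ∫⁻ Y, ENNReal.ofReal (ginibrePDF n (A * Y)) * f Y ∂(matrixLebesgue n)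
          ∂(realGinibre n) := by
        refine lintegral_congr_ae ?_
        -- Singular `A`, for which the substitution fails, form a null set.
        filter_upwards [ae_det_ne_zero_realGinibre n] with A hA using hinner A hA
    _ = ∫⁻ A, ∫⁻ Y, ENNReal.ofReal (|A.det| ^ n * (ginibrePDF n A * ginibrePDF n (A * Y))) * f Y
          ∂(matrixLebesgue n) ∂(matrixLebesgue n) := by
        rw [lintegral_realGinibre hqa]
        refine lintegral_congr fun A => ?_
        rw [← mul_assoc, ← ENNReal.ofReal_mul (ginibrePDF_nonneg _ _),
          ← lintegral_const_mul _ (hq1 A)]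
        refine lintegral_congr fun Y => ?_
        rw [← mul_assoc, ← ENNReal.ofReal_mul
          (mul_nonneg (ginibrePDF_nonneg _ _) (by positivity))]
        congr 2
        ring
    _ = ∫⁻ Y, ∫⁻ A, ENNReal.ofReal (|A.det| ^ n * (ginibrePDF n A * ginibrePDF n (A * Y))) * f Y
          ∂(matrixLebesgue n) ∂(matrixLebesgue n) :=
        lintegral_lintegral_swap (hpm.mul (hfm.comp measurable_snd)).aemeasurable
    _ = ∫⁻ Y, ENNReal.ofReal (matrixCauchyDensity n Y) * f Y ∂(matrixLebesgue n) := by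
        refine lintegral_congr fun Y => ?_
        rw [lintegral_mul_const _ (hp1 Y),
          lintegral_fibre_eq_matrixCauchyDensity]
    _ = ∫⁻ Y in s, ENNReal.ofReal (matrixCauchyDensity n Y) ∂(matrixLebesgue n) := by
        rw [← lintegral_indicator hs]
        refine lintegral_congr fun Y => ?_
        by_cases hY : Y ∈ s <;> simp [hf, hY]

theorem proposition2p1 {Ω : Type*} [MeasurableSpace Ω] (P : Measure Ω) [IsProbabilityMeasure P]
    (N : ℕ) (A B : Ω → Matrix (Fin N) (Fin N) ℝ)
    (hA : HasLaw A (realGinibre N) P) (hB : HasLaw B (realGinibre N) P)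
    (hAB : IndepFun A B P) :
    (∀ᵐ ω ∂P, IsUnit (A ω)) ∧
      HasLaw (fun ω => (A ω)⁻¹ * B ω)
        ((matrixLebesgue N).withDensity
          fun Y => ENNReal.ofReal (matrixCauchyDensity N Y)) P := by
  refine ⟨?_, ?_⟩
  · have h := ae_det_ne_zero_realGinibre N
    rw [← hA.map_eq] at h
    filter_upwards [ae_of_ae_map hA.aemeasurable h] with ω hω
    exact (Matrix.isUnit_iff_isUnit_det _).2 (isUnit_iff_ne_zero.2 hω)
  · have hpair : P.map (fun ω => (A ω, B ω)) = (realGinibre N).prod (realGinibre N) := by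
      rw [(indepFun_iff_map_prod_eq_prod_map_map hA.aemeasurable hB.aemeasurable).1 hAB,
        hA.map_eq, hB.map_eq]
    have hAB' : AEMeasurable (fun ω => (A ω, B ω)) P := hA.aemeasurable.prodMk hB.aemeasurable
    have hpair' : HasLaw (fun ω => (A ω, B ω)) ((realGinibre N).prod (realGinibre N)) P :=
      ⟨hAB', hpair⟩
    have hlaw : HasLaw (fun p : Matrix (Fin N) (Fin N) ℝ × Matrix (Fin N) (Fin N) ℝ => p.1⁻¹ * p.2)
        ((matrixLebesgue N).withDensity fun Y => ENNReal.ofReal (matrixCauchyDensity N Y))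
        ((realGinibre N).prod (realGinibre N)) :=
      ⟨(measurable_inv_mul N).aemeasurable, map_inv_mul_realGinibre N⟩
    have hcomp := hlaw.fun_comp hpair'
    exact hcomp
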